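/- Let $K$ be a field and let $0\neq q\in K$. For $k\in\mathbb Z$ put $\{k\}_q=\frac{q^k-1}{q-1}$ if $q\ne1$ and $\{k\}_1=k\cdot 1_K$, and assume that $\{k\}_q=0$ if and only if $k=0$. Let $\mathcal H_q$ be the $q$-deformed Heisenberg algebra, i.e. the unital associative $K$-algebra generated by $A,B$ subject to $AB-qBA=1$; every element can be written uniquely as a finite sum $\sum_j c_j(B)A^j$ with $c_j\in K[X]$. Let $m,n\ge1$ and let $$P=\sum_{j=0}^m p_j(B)A^j,\qquad Q=\sum_{j=0}^n q_j(B)A^j\qquad(p_j,q_j\in K[X],\ p_m\neq0,\ q_n\neq0)$$ be commuting elements of $\mathcal H_q$. Write $A^kP=\sum_{j}p_{k,j}(B)A^j$ for $0\le k\le n-1$ and $A^lQ=\sum_{j}q_{l,j}(B)A^j$ for $0\le l\le m-1$, with $p_{k,j},q_{l,j}\in K[X]$. The eliminant $\Delta_{P,Q}(M,\lambda,\mu)\in K[M,\lambda,\mu]$ is the determinant of the $(m+n)\times(m+n)$ matrix whose columns are indexed by $j=0,\dots,m+n-1$, whose first $n$ rows are $\big(p_{k,j}(M)-\lambda\,[j=k]\big)_j$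 for $k=0,\dots,n-1$, and whose last $m$ rows are $\big(q_{l,j}(M)-\mu\,[j=l]\big)_j$ for $l=0,\dots,m-1$; here $[\,\cdot\,]$ is $1$ if the condition holds and $0$ otherwise. Then $\Delta_{P,Q}\neq0$. More precisely, if $q_n=\sum_i a_iX^i$ and $p_m=\sum_i b_iX^i$ with $a_i,b_i\in K$, then: - $\Delta_{P,Q}$ has degree $n$ as a polynomial in $\lambda$, and its non-zero coefficient of $\lambda^n$ is $(-1)^n\prod_{k=0}^{m-1}\big(\sum_i a_iq^{ki}M^i\big)$; - $\Delta_{P,Q}$ has degree $m$ as a polynomial in $\mu$, and its non-zero coefficient of $\mu^m$ is $(-1)^{m(n+1)}\prod_{k=0}^{n-1}\big(\sum_i b_iq^{ki}M^i\big)$. Let $$s=n\max_j\deg p_j+m\max_j\deg q_j,\qquad t=\tfrac12n(n-1)\max_j\deg p_j+\tfrac12m(m-1)\max_j\deg q_j.$$ Then the degree of $\Delta_{P,Q}$ in $M$ is at most $s$. Define $\delta_i\in K[\lambda,\mu]$ for $0\le i\le s$ by $\Delta_{P,Q}(M,\lambda,\mu)=\sum_{i=0}^s\delta_i(\lambda,\mu)M^i$.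 Then: 1. every coefficient of every $\delta_i$ can be written as $\sum_{l=0}^t r_lq^l$ with all $r_l$ in the subring of $K$ generated by the coefficients of all the $p_j$ and $q_j$; 2. at least one $\delta_i$ is non-zero; 3. $\delta_i(P,Q)=0$ in $\mathcal H_q$ for all $i=0,\dots,s$. -/

import Mathlib

open scoped Polynomial

noncomputable section

namespace QHeisenberg

/-- The `q`-integer `{n}_q`, for `n : ℤ`. -/
def qInt {K : Type*} [Field K] (q : K) (n : ℤ) : K :=
  open Classical in if q = 1 then (n : K) else (q ^ n - 1) / (q - 1)

theorem qInt_zero {K : Type*} [Field K] (q : K) : qInt q 0 = 0 := by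
  simp [qInt]

theorem qInt_succ {K : Type*} [Field K] (q : K) (n : ℕ) :
    qInt q ((n + 1 : ℕ) : ℤ) = 1 + q * qInt q (n : ℤ) := by
  unfold qInt
  split_ifs with h
  · subst h; push_cast; ring
  · have h' : q - 1 ≠ 0 := sub_ne_zero.mpr h
    rw [zpow_natCast, zpow_natCast]
    field_simp
    ring

/-- The two generators of the algebra. -/
inductive Gen : Type
  | A
  | B

/-- The relation `A B = q B A + 1` on the free algebra on `A` and `B`. -/
inductive Rel {K : Type*} [Field K] (q : K) : FreeAlgebra K Gen → FreeAlgebra K Gen → Prop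
  | comm : Rel q (FreeAlgebra.ι K Gen.A * FreeAlgebra.ι K Gen.B)
      (q • (FreeAlgebra.ι K Gen.B * FreeAlgebra.ι K Gen.A) + 1)

/-- The `q`-deformed Heisenberg algebra: the unital associative `K`-algebra generated by `A` and
`B` subject to `A B - q B A = 1`. -/
abbrev Heis {K : Type*} [Field K] (q : K) : Type _ := RingQuot (Rel q)

/-- The generator `A` (acting as `D_q` on Laurent series). -/
def opA {K : Type*} [Field K] (q : K) : Heis q :=
  RingQuot.mkAlgHom K (Rel q) (FreeAlgebra.ι K Gen.A)

/-- The generator `B` (acting as `M`, multiplication by the variable, on Laurent series). -/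
def opB {K : Type*} [Field K] (q : K) : Heis q :=
  RingQuot.mkAlgHom K (Rel q) (FreeAlgebra.ι K Gen.B)

theorem opA_mul_opB {K : Type*} [Field K] (q : K) :
    opA q * opB q = q • (opB q * opA q) + 1 := by
  have h := RingQuot.mkAlgHom_rel K (Rel.comm (q := q))
  simpa [opA, opB] using h

/-- The normally ordered element `∑_{j=0}^m p_j(B) A^j`. -/
def ofCoeffs {K : Type*} [Field K] (q : K) {m : ℕ} (p : Fin (m + 1) → K[X]) : Heis q :=
  ∑ j : Fin (m + 1), Polynomial.aeval (opB q) (p j) * opA q ^ (j : ℕ)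

/-! Normally ordered coefficients. A polynomial `∑_j p_j Y^j` with `p_j ∈ K[X]` stands for
`∑_j p_j(B) A^j`. Left multiplication by `A` and `B` is computed on such expressions by
`A p(B) = p(qB) A + (D_q p)(B)`, and `normalForm P` is the expression obtained from `1` by left
multiplication by `P`. -/

/-- `p(X) ↦ p(qX)`. -/
def qShift {K : Type*} [Field K] (q : K) : K[X] →ₐ[K] K[X] :=
  Polynomial.aeval (Polynomial.C q * Polynomial.X)

/-- The `q`-derivative `X^i ↦ {i}_q X^(i-1)`. -/
def qDeriv {K : Type*} [Field K] (q : K) : K[X] →ₗ[K] K[X] :=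
  Polynomial.lsum fun i => qInt q (i : ℤ) • Polynomial.monomial (i - 1)

/-- Left multiplication by `A`: `p Y^j ↦ p(qX) Y^(j+1) + (D_q p) Y^j`. -/
def leftA {K : Type*} [Field K] (q : K) : Module.End K K[X][X] :=
  Polynomial.lsum fun j =>
    (Polynomial.monomial (j + 1) : K[X] →ₗ[K[X]] K[X][X]).restrictScalars K
        ∘ₗ (qShift q).toLinearMap
      + (Polynomial.monomial j : K[X] →ₗ[K[X]] K[X][X]).restrictScalars K ∘ₗ qDeriv q

/-- Left multiplication by `B`: `p Y^j ↦ X p Y^j`. -/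
def leftB (K : Type*) [Field K] : Module.End K K[X][X] :=
  LinearMap.mulLeft K (Polynomial.C Polynomial.X)

theorem leftA_monomial {K : Type*} [Field K] (q : K) (j : ℕ) (f : K[X]) :
    leftA q (Polynomial.monomial j f) =
      Polynomial.monomial (j + 1) (qShift q f) + Polynomial.monomial j (qDeriv q f) := by
  simp [leftA, Polynomial.lsum_apply]

theorem leftB_monomial {K : Type*} [Field K] (j : ℕ) (f : K[X]) :
    leftB K (Polynomial.monomial j f) = Polynomial.monomial j (Polynomial.X * f) := by
  simp [leftB, Polynomial.C_mul_monomial]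

theorem qDeriv_monomial {K : Type*} [Field K] (q : K) (i : ℕ) (a : K) :
    qDeriv q (Polynomial.monomial i a) = Polynomial.monomial (i - 1) (qInt q (i : ℤ) * a) := by
  simp [qDeriv, Polynomial.lsum_apply, Polynomial.smul_monomial]

theorem qDeriv_X_mul {K : Type*} [Field K] (q : K) (f : K[X]) :
    qDeriv q (Polynomial.X * f) = q • (Polynomial.X * qDeriv q f) + f := by
  induction f using Polynomial.induction_on' with
  | add f g hf hg => rw [mul_add, map_add, hf, hg, map_add, mul_add, smul_add]; abel
  | monomial i a =>
    rw [Polynomial.X_mul_monomial, qDeriv_monomial, qDeriv_monomial, qInt_succ,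
      Polynomial.X_mul_monomial, Polynomial.smul_monomial]
    rcases i with _ | i
    · simp [qInt_zero]
    · simp only [Nat.add_sub_cancel, smul_eq_mul]
      rw [← map_add]
      congr 1
      ring

theorem leftA_mul_leftB {K : Type*} [Field K] (q : K) :
    leftA q * leftB K = q • (leftB K * leftA q) + 1 := by
  refine LinearMap.ext fun f => ?_
  induction f using Polynomial.induction_on' with
  | add f g hf hg => rw [map_add, hf, hg, map_add]
  | monomial j f =>
    simp only [Module.End.mul_apply, LinearMap.add_apply, LinearMap.smul_apply,
      Module.End.one_apply, leftA_monomial, leftB_monomial, map_add, qDeriv_X_mul, map_mul]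
    rw [smul_add, Polynomial.smul_monomial, Polynomial.smul_monomial, add_assoc]
    congr 2
    simp [qShift, Polynomial.smul_eq_C_mul, mul_assoc]

/-- The algebra acting on normally ordered expressions by left multiplication. -/
def leftAction {K : Type*} [Field K] (q : K) : Heis q →ₐ[K] Module.End K K[X][X] :=
  RingQuot.liftAlgHom K ⟨FreeAlgebra.lift K fun g : Gen =>
      match g with
      | Gen.A => leftA q
      | Gen.B => leftB K, by
    rintro _ _ ⟨⟩
    simpa using leftA_mul_leftB q⟩

theorem leftAction_opA {K : Type*} [Field K] (q : K) : leftAction q (opA q) = leftA q := by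
  simp [leftAction, opA]

theorem leftAction_opB {K : Type*} [Field K] (q : K) : leftAction q (opB q) = leftB K := by
  simp [leftAction, opB]

/-- The polynomial `∑_j p_j Y^j` over `K[X]` with `P = ∑_j p_j(B) A^j`. -/
def normalForm {K : Type*} [Field K] (q : K) (P : Heis q) : K[X][X] :=
  leftAction q P 1

/-- `normalForm` computes the coefficients of any normally ordered expression; in particular
the coefficients `p_j` are uniquely determined by the element. -/
theorem normalForm_sum {K : Type*} [Field K] (q : K) (N : ℕ) (p : ℕ → K[X]) :
    normalForm q (∑ j ∈ Finset.range N, Polynomial.aeval (opB q) (p j) * opA q ^ j) =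
      ∑ j ∈ Finset.range N, Polynomial.monomial j (p j) := by
  have hA : ∀ j : ℕ, (leftA q ^ j) 1 = Polynomial.monomial j 1 := by
    intro j
    induction j with
    | zero => simp
    | succ j ih =>
      rw [pow_succ', Module.End.mul_apply, ih, leftA_monomial]
      have : qDeriv q (1 : K[X]) = 0 := by
        have := qDeriv_monomial q 0 1
        simpa [qInt_zero] using this
      simp [this]
  have hB : ∀ (f : K[X]) (g : K[X][X]),
      (Polynomial.aeval (leftB K) f) g = Polynomial.C f * g := by
    intro f g
    induction f using Polynomial.induction_on' with
    | add f h hf hh => rw [map_add, LinearMap.add_apply, hf, hh, map_add, add_mul]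
    | monomial i a =>
      rw [Polynomial.aeval_monomial, leftB, LinearMap.pow_mulLeft, Module.End.mul_apply,
        Module.algebraMap_end_apply, LinearMap.mulLeft_apply, ← Polynomial.C_mul_X_pow_eq_monomial,
        map_mul, map_pow, mul_assoc, Algebra.smul_def]
      rfl
  simp only [normalForm, map_sum, map_mul, map_pow, LinearMap.sum_apply, Module.End.mul_apply,
    leftAction_opA, ← Polynomial.aeval_algHom_apply, leftAction_opB, hA, hB,
    Polynomial.C_mul_monomial, mul_one]

/-- The expression `∑_j p_j Y^j`, read back as `∑_j p_j(B) A^j`. -/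
def ofNormal {K : Type*} [Field K] (q : K) : K[X][X] →ₗ[K] Heis q :=
  Polynomial.lsum fun j =>
    LinearMap.mulRight K (opA q ^ j) ∘ₗ (Polynomial.aeval (opB q)).toLinearMap

theorem ofNormal_monomial {K : Type*} [Field K] (q : K) (j : ℕ) (f : K[X]) :
    ofNormal q (Polynomial.monomial j f) = Polynomial.aeval (opB q) f * opA q ^ j := by
  simp [ofNormal, Polynomial.lsum_apply]

theorem opA_mul_aeval {K : Type*} [Field K] (q : K) (f : K[X]) :
    opA q * Polynomial.aeval (opB q) f =
      Polynomial.aeval (opB q) (qShift q f) * opA q + Polynomial.aeval (opB q) (qDeriv q f) := by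
  induction f using Polynomial.induction_on with
  | C a =>
    have h : qDeriv q (Polynomial.C a) = 0 := by
      rw [← Polynomial.monomial_zero_left, qDeriv_monomial]; simp [qInt_zero]
    rw [h]
    simp [qShift, Algebra.commutes]
  | add f g hf hg => simp only [map_add, mul_add, add_mul, hf, hg]; abel
  | monomial n a ih =>
    have e : (Polynomial.C a * Polynomial.X ^ (n + 1) : K[X]) =
        Polynomial.X * (Polynomial.C a * Polynomial.X ^ n) := by ring
    rw [e]
    generalize (Polynomial.C a * Polynomial.X ^ n : K[X]) = g at ih
    have hs : qShift q (Polynomial.X * g) = q • (Polynomial.X * qShift q g) := by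
      simp [qShift, Polynomial.smul_eq_C_mul, mul_assoc]
    rw [qDeriv_X_mul, hs]
    simp only [map_mul, map_add, map_smul, Polynomial.aeval_X]
    rw [← mul_assoc, opA_mul_opB, add_mul, smul_mul_assoc, mul_assoc, ih]
    simp only [mul_add, smul_add, one_mul, smul_mul_assoc, mul_assoc, add_assoc]

/-- Every element is the normally ordered expression given by its `normalForm`. -/
theorem ofNormal_normalForm {K : Type*} [Field K] (q : K) (P : Heis q) :
    ofNormal q (normalForm q P) = P := by
  have key : ∀ (x : FreeAlgebra K Gen) (f : K[X][X]),
      ofNormal q (leftAction q (RingQuot.mkAlgHom K (Rel q) x) f) =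
        RingQuot.mkAlgHom K (Rel q) x * ofNormal q f := by
    intro x
    induction x using FreeAlgebra.induction with
    | grade0 r =>
      intro f
      rw [AlgHom.commutes, AlgHom.commutes, Module.algebraMap_end_apply, map_smul,
        Algebra.smul_def]
    | grade1 g =>
      intro f
      induction f using Polynomial.induction_on' with
      | add f g hf hg => rw [map_add, map_add, hf, hg, map_add, mul_add]
      | monomial j f =>
        cases g with
        | A =>
          change ofNormal q (leftAction q (opA q) _) = opA q * _
          rw [leftAction_opA, leftA_monomial, map_add]
          simp only [ofNormal_monomial]
          rw [← mul_assoc, opA_mul_aeval, add_mul, pow_succ', mul_assoc]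
        | B =>
          change ofNormal q (leftAction q (opB q) _) = opB q * _
          rw [leftAction_opB, leftB_monomial]
          simp only [ofNormal_monomial]
          rw [map_mul, Polynomial.aeval_X, mul_assoc]
    | mul x y hx hy => intro f; rw [map_mul, map_mul, Module.End.mul_apply, hx, hy, mul_assoc]
    | add x y hx hy => intro f; rw [map_add, map_add, LinearMap.add_apply, map_add, hx, hy, add_mul]
  obtain ⟨x, rfl⟩ := RingQuot.mkAlgHom_surjective K (Rel q) P
  have h1 : ofNormal q 1 = 1 := by
    have := ofNormal_monomial q 0 1
    simpa using this
  rw [normalForm, key, h1, mul_one]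

/-- The matrix whose determinant is the eliminant of `P` and `Q` (of orders `m` and `n`), with
entries in `K[M, lam, mu]`, where `M`, `lam`, `mu` are the variables with index `0`, `1`, `2`.
Row `k < n` holds the coefficients of `A^0, …, A^(m+n-1)` in `A^k P - lam A^k`, and row `n + l`
with `l < m` those in `A^l Q - mu A^l`. -/
def eliminantMatrix {K : Type*} [Field K] (q : K) (m n : ℕ) (P Q : Heis q) :
    Matrix (Fin (m + n)) (Fin (m + n)) (MvPolynomial (Fin 3) K) :=
  Matrix.of fun i j =>
    if (i : ℕ) < n then
      Polynomial.aeval (MvPolynomial.X 0) ((normalForm q (opA q ^ (i : ℕ) * P)).coeff j)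
        - (if (j : ℕ) = i then MvPolynomial.X 1 else 0)
    else
      Polynomial.aeval (MvPolynomial.X 0) ((normalForm q (opA q ^ ((i : ℕ) - n) * Q)).coeff j)
        - (if (j : ℕ) = i - n then MvPolynomial.X 2 else 0)

/-- The eliminant of `P` and `Q`, a polynomial in `M`, `lam`, `mu`. -/
def eliminant {K : Type*} [Field K] (q : K) (m n : ℕ) (P Q : Heis q) : MvPolynomial (Fin 3) K :=
  (eliminantMatrix q m n P Q).det

/-- A polynomial in three variables, seen as a polynomial in the variable with index `v`; the
coefficients are polynomials in the two other variables, which keep their order and are numbered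
`0`, `1`. -/
def inVar {K : Type*} [Field K] (v : Fin 3) :
    MvPolynomial (Fin 3) K →ₐ[K] Polynomial (MvPolynomial (Fin 2) K) :=
  MvPolynomial.aeval
    (v.insertNth Polynomial.X fun j => Polynomial.C (MvPolynomial.X j) :
      Fin 3 → Polynomial (MvPolynomial (Fin 2) K))

/-- `delta_i(lam, mu)`, the coefficient of `M^i` in the eliminant, a polynomial in the variables
`lam` and `mu` with index `0` and `1`. -/
def eliminantCoeff {K : Type*} [Field K] (q : K) (m n : ℕ) (P Q : Heis q) (i : ℕ) :
    MvPolynomial (Fin 2) K :=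
  (inVar 0 (eliminant q m n P Q)).coeff i

/-- `f(P, Q) = ∑ c_{a,b} P^a Q^b` for `f = ∑ c_{a,b} lam^a mu^b`. -/
def evalPair {K : Type*} [Field K] {q : K} (f : MvPolynomial (Fin 2) K) (P Q : Heis q) : Heis q :=
  ∑ d ∈ f.support, f.coeff d • (P ^ d 0 * Q ^ d 1)

/-- `∑_i a_i c^i M^i` for `f = ∑_i a_i X^i`, as a polynomial in two variables of which the one
with index `0` is `M`. -/
def scaled {K : Type*} [Field K] (c : K) (f : K[X]) : MvPolynomial (Fin 2) K :=
  ∑ i ∈ f.support, MvPolynomial.C (f.coeff i * c ^ i) * MvPolynomial.X 0 ^ i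

/-- `max_j deg p_j`. -/
def maxDeg {K : Type*} [Field K] {m : ℕ} (p : Fin (m + 1) → K[X]) : ℕ :=
  Finset.univ.sup fun j => (p j).natDegree

/-- The subring of `K` generated by the coefficients of all the `p_j` and `r_j`. -/
def coeffRing {K : Type*} [Field K] {m n : ℕ} (p : Fin (m + 1) → K[X]) (r : Fin (n + 1) → K[X]) :
    Subring K :=
  Subring.closure ({a | ∃ j i, (p j).coeff i = a} ∪ {a | ∃ j i, (r j).coeff i = a})

end QHeisenberg

end

namespace QHeisenberg

open Polynomial

section Shift

variable {K : Type*} [Field K] {q : K}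

theorem coeff_qShift (f : K[X]) (i : ℕ) : (qShift q f).coeff i = q ^ i * f.coeff i := by
  induction f using Polynomial.induction_on' with
  | add f g hf hg => rw [map_add, coeff_add, coeff_add, hf, hg, mul_add]
  | monomial j a =>
    rw [qShift, aeval_monomial, mul_pow, ← C_pow, algebraMap_eq, ← mul_assoc, ← C_mul,
      C_mul_X_pow_eq_monomial, coeff_monomial, coeff_monomial]
    split_ifs with h
    · subst h; ring
    · simp

theorem coeff_qDeriv (f : K[X]) (i : ℕ) :
    (qDeriv q f).coeff i = qInt q ((i + 1 : ℕ) : ℤ) * f.coeff (i + 1) := by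
  induction f using Polynomial.induction_on' with
  | add f g hf hg => rw [map_add, coeff_add, coeff_add, hf, hg, mul_add]
  | monomial j a =>
    rw [qDeriv_monomial, coeff_monomial, coeff_monomial]
    rcases j with _ | j
    · simp [qInt_zero]
    · by_cases h : j = i
      · subst h; simp
      · simp [h]

theorem coeff_qShift_iterate (k : ℕ) (f : K[X]) (i : ℕ) :
    ((qShift q)^[k] f).coeff i = (q ^ k) ^ i * f.coeff i := by
  induction k with
  | zero => simp
  | succ k ih => rw [Function.iterate_succ_apply', coeff_qShift, ih, pow_succ]; ring

theorem natDegree_qShift_iterate (hq0 : q ≠ 0) (k : ℕ) (f : K[X]) :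
    ((qShift q)^[k] f).natDegree = f.natDegree := by
  apply natDegree_eq_natDegree
  refine le_antisymm ?_ ?_ <;> refine (degree_le_iff_coeff_zero _ _).2 fun i hi => ?_
  · rw [coeff_qShift_iterate, coeff_eq_zero_of_degree_lt hi, mul_zero]
  · have := coeff_eq_zero_of_degree_lt hi
    rw [coeff_qShift_iterate] at this
    exact (mul_eq_zero.1 this).resolve_left (pow_ne_zero _ (pow_ne_zero _ hq0))

theorem qShift_one (f : K[X]) : qShift (1 : K) f = f := by
  ext i; simp [coeff_qShift]

theorem qDeriv_one (f : K[X]) : qDeriv (1 : K) f = derivative f := by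
  ext i; simp [coeff_qDeriv, coeff_derivative, qInt, mul_comm]

theorem natDegree_qShift_le (f : K[X]) : (qShift q f).natDegree ≤ f.natDegree :=
  natDegree_le_iff_coeff_eq_zero.2 fun i hi => by
    rw [coeff_qShift, coeff_eq_zero_of_natDegree_lt hi, mul_zero]

theorem natDegree_qDeriv_le (f : K[X]) : (qDeriv q f).natDegree ≤ f.natDegree :=
  natDegree_le_iff_coeff_eq_zero.2 fun i hi => by
    rw [coeff_qDeriv, coeff_eq_zero_of_natDegree_lt (hi.trans i.lt_succ_self), mul_zero]

theorem coeff_leftA_zero (g : K[X][X]) : (leftA q g).coeff 0 = qDeriv q (g.coeff 0) := by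
  induction g using Polynomial.induction_on' with
  | add f g hf hg => simp only [map_add, coeff_add, hf, hg]
  | monomial j a =>
    rw [leftA_monomial, coeff_add, coeff_monomial, coeff_monomial, coeff_monomial]
    split_ifs <;> simp_all

theorem coeff_leftA_succ (g : K[X][X]) (i : ℕ) :
    (leftA q g).coeff (i + 1) = qShift q (g.coeff i) + qDeriv q (g.coeff (i + 1)) := by
  induction g using Polynomial.induction_on' with
  | add f g hf hg => simp only [map_add, coeff_add, hf, hg]; abel
  | monomial j a =>
    rw [leftA_monomial, coeff_add, coeff_monomial, coeff_monomial, coeff_monomial, coeff_monomial]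
    split_ifs <;> simp_all

theorem natDegree_leftA_pow_le {g : K[X][X]} {d : ℕ} (hg : g.natDegree ≤ d) (k : ℕ) :
    ((leftA q ^ k) g).natDegree ≤ d + k := by
  induction k with
  | zero => simpa using hg
  | succ k ih =>
    rw [pow_succ', Module.End.mul_apply]
    refine natDegree_le_iff_coeff_eq_zero.2 fun i hi => ?_
    obtain ⟨i, rfl⟩ := Nat.exists_eq_add_one_of_ne_zero (by omega : i ≠ 0)
    rw [coeff_leftA_succ, coeff_eq_zero_of_natDegree_lt (by omega),
      coeff_eq_zero_of_natDegree_lt (by omega), map_zero, map_zero, add_zero]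

theorem coeff_leftA_pow_top {g : K[X][X]} {d : ℕ} (hg : g.natDegree ≤ d) (k : ℕ) :
    ((leftA q ^ k) g).coeff (d + k) = (qShift q)^[k] (g.coeff d) := by
  induction k with
  | zero => simp
  | succ k ih =>
    rw [pow_succ', Module.End.mul_apply, ← add_assoc, coeff_leftA_succ, ih,
      coeff_eq_zero_of_natDegree_lt (Nat.lt_succ_of_le (natDegree_leftA_pow_le hg k)), map_zero,
      add_zero, Function.iterate_succ_apply']

theorem coeff_leftA_one_pow_next {g : K[X][X]} {d : ℕ} (hg : g.natDegree ≤ d) (k i : ℕ)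
    (hi : i + 1 = d + k) :
    ((leftA (1 : K) ^ k) g).coeff i = (X * g).coeff d + k • derivative (g.coeff d) := by
  induction k generalizing i with
  | zero =>
    obtain rfl : d = i + 1 := by omega
    simp
  | succ k ih =>
    have htop := coeff_leftA_pow_top (q := (1 : K)) hg k
    have hid : ∀ f : K[X], (qShift (1 : K))^[k] f = f := fun f => by
      ext j; simp [coeff_qShift_iterate]
    rw [hid] at htop
    rw [pow_succ', Module.End.mul_apply]
    obtain rfl : i = d + k := by omega
    rcases h : d + k with _ | i
    · obtain ⟨rfl, rfl⟩ : d = 0 ∧ k = 0 := by omega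
      rw [coeff_leftA_zero]
      simp [qDeriv_one]
    · rw [coeff_leftA_succ, ih i h.symm, ← h, htop, qShift_one, qDeriv_one, succ_nsmul, add_assoc]

end Shift

section Order

variable {K : Type*} [Field K] {q : K}

theorem leftAction_aeval_opB (f : K[X]) (g : K[X][X]) :
    leftAction q (aeval (opB q) f) g = C f * g := by
  rw [← aeval_algHom_apply, leftAction_opB]
  induction f using Polynomial.induction_on' with
  | add f h hf hh => rw [map_add, LinearMap.add_apply, hf, hh, map_add, add_mul]
  | monomial i a =>
    rw [aeval_monomial, leftB, LinearMap.pow_mulLeft, Module.End.mul_apply,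
      Module.algebraMap_end_apply, LinearMap.mulLeft_apply, ← C_mul_X_pow_eq_monomial,
      map_mul, map_pow, mul_assoc, Algebra.smul_def]
    rfl

theorem normalForm_mul (x y : Heis q) :
    normalForm q (x * y) =
      (normalForm q x).sum fun j f => C f * (leftA q ^ j) (normalForm q y) := by
  have h : x = (normalForm q x).sum fun j f => aeval (opB q) f * opA q ^ j := by
    conv_lhs => rw [← ofNormal_normalForm q x]
    simp [ofNormal, lsum_apply]
  have h2 : normalForm q (x * y) = leftAction q x (normalForm q y) := by
    rw [normalForm, map_mul, Module.End.mul_apply, normalForm]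
  rw [h2]
  conv_lhs => rw [h]
  simp only [Polynomial.sum_def, map_sum, LinearMap.sum_apply, map_mul, Module.End.mul_apply,
    leftAction_aeval_opB, map_pow, leftAction_opA]

theorem normalForm_opA_pow_mul (k : ℕ) (x : Heis q) :
    normalForm q (opA q ^ k * x) = (leftA q ^ k) (normalForm q x) := by
  rw [normalForm, map_mul, Module.End.mul_apply, map_pow, leftAction_opA, normalForm]

theorem normalForm_opB_pow_mul (k : ℕ) (x : Heis q) :
    normalForm q (opB q ^ k * x) = C (X ^ k) * normalForm q x := by
  have := leftAction_aeval_opB (q := q) (X ^ k) (normalForm q x)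
  rw [map_pow, aeval_X] at this
  rw [← this, normalForm, map_mul, Module.End.mul_apply, normalForm]

theorem coeff_normalForm_mul_top {x y : Heis q} {m d : ℕ} (hx : (normalForm q x).natDegree ≤ m)
    (hy : (normalForm q y).natDegree ≤ d) :
    (normalForm q (x * y)).coeff (m + d) =
      (normalForm q x).coeff m * (qShift q)^[m] ((normalForm q y).coeff d) := by
  rw [normalForm_mul, sum_over_range' _ (by simp) (m + 1) (by omega), finsetSum_coeff,
    Finset.sum_range_succ, Finset.sum_eq_zero, zero_add, coeff_C_mul, add_comm m d,
    coeff_leftA_pow_top hy]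
  intro j hj
  rw [coeff_C_mul, coeff_eq_zero_of_natDegree_lt (p := (leftA q ^ j) _), mul_zero]
  have := natDegree_leftA_pow_le (q := q) hy j
  have := Finset.mem_range.1 hj
  omega

theorem coeff_normalForm_one_mul_next {x y : Heis (1 : K)} {m d i : ℕ}
    (hx : (normalForm 1 x).natDegree ≤ m) (hy : (normalForm 1 y).natDegree ≤ d)
    (hi : i + 1 = m + d) :
    (normalForm 1 (x * y)).coeff i =
      (normalForm 1 x).coeff m * (X * normalForm 1 y).coeff d
      + (X * normalForm 1 x).coeff m * (normalForm 1 y).coeff d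
      + m • ((normalForm 1 x).coeff m * derivative ((normalForm 1 y).coeff d)) := by
  have hid : ∀ (k : ℕ) (f : K[X]), (qShift (1 : K))^[k] f = f := fun k f => by
    ext j; simp [coeff_qShift_iterate]
  have small : ∀ j, d + j < i →
      (C ((normalForm 1 x).coeff j) * (leftA 1 ^ j) (normalForm 1 y)).coeff i = 0 := by
    intro j hj
    rw [coeff_C_mul, coeff_eq_zero_of_natDegree_lt (p := (leftA 1 ^ j) _), mul_zero]
    exact (natDegree_leftA_pow_le hy j).trans_lt hj
  rw [normalForm_mul, sum_over_range' _ (by simp) (m + 1) (by omega), finsetSum_coeff,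
    Finset.sum_range_succ, coeff_C_mul, coeff_leftA_one_pow_next hy m i (by omega)]
  rcases m with _ | m
  · simp
  · rw [Finset.sum_range_succ, Finset.sum_eq_zero, zero_add, coeff_C_mul, coeff_X_mul]
    · obtain rfl : i = d + m := by omega
      rw [coeff_leftA_pow_top hy, hid]
      simp only [nsmul_eq_mul]
      ring
    · intro j hj
      have := Finset.mem_range.1 hj
      exact small j (by omega)

theorem qInt_eq_zero_of_pow_eq (hq1 : q ≠ 1) (hq0 : q ≠ 0) {a b : ℕ} (h : q ^ a = q ^ b) :
    qInt q ((a : ℤ) - b) = 0 := by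
  rw [qInt, if_neg hq1, zpow_sub₀ hq0, zpow_natCast, zpow_natCast, h,
    div_self (pow_ne_zero _ hq0), sub_self, zero_div]

/-- The degree of the leading coefficient of an element commuting with `P` is determined by the
order of that element. -/
theorem natDegree_leadingCoeff_of_commute (hq0 : q ≠ 0) (hq : ∀ k : ℤ, qInt q k = 0 ↔ k = 0)
    {x y : Heis q} (hxy : x * y = y * x) (hx : normalForm q x ≠ 0) (hy : normalForm q y ≠ 0) :
    (normalForm q x).natDegree * (normalForm q y).leadingCoeff.natDegree =
      (normalForm q y).natDegree * (normalForm q x).leadingCoeff.natDegree := by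
  set m := (normalForm q x).natDegree with hm
  set d := (normalForm q y).natDegree with hd
  have hf : (normalForm q x).coeff m ≠ 0 := leadingCoeff_ne_zero.2 hx
  have hg : (normalForm q y).coeff d ≠ 0 := leadingCoeff_ne_zero.2 hy
  change m * ((normalForm q y).coeff d).natDegree = d * ((normalForm q x).coeff m).natDegree
  have key : qInt q (((m * ((normalForm q y).coeff d).natDegree : ℕ) : ℤ) -
      ((d * ((normalForm q x).coeff m).natDegree : ℕ) : ℤ)) = 0 := by
    by_cases hq1 : q = 1
    · subst hq1
      rcases h : m + d with _ | i
      · obtain ⟨h1, h2⟩ : m = 0 ∧ d = 0 := by omega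
        rw [h1, h2]; simp [qInt_zero]
      have h1 := coeff_normalForm_one_mul_next hm.symm.le hd.symm.le h.symm
      have h2 := coeff_normalForm_one_mul_next hd.symm.le hm.symm.le (h.symm.trans (add_comm m d))
      rw [hxy, h2] at h1
      set f := (normalForm 1 x).coeff m
      set g := (normalForm 1 y).coeff d
      have h3 : (m : K[X]) * (f * (X * derivative g)) = (d : K[X]) * (g * (X * derivative f)) := by
        simp only [nsmul_eq_mul] at h1
        linear_combination (-X) * h1
      have hc : ∀ u v : K[X], (u * (X * derivative v)).coeff (u.natDegree + v.natDegree) =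
          u.leadingCoeff * (v.leadingCoeff * v.natDegree) := by
        intro u v
        have hv : (X * derivative v).natDegree ≤ v.natDegree := by
          refine natDegree_le_iff_coeff_eq_zero.2 fun i hi => ?_
          rcases i with _ | i
          · simp
          · rw [coeff_X_mul, coeff_derivative, coeff_eq_zero_of_natDegree_lt hi, zero_mul]
        rw [coeff_mul_add_eq_of_natDegree_le le_rfl hv]
        congr 1
        rcases h : v.natDegree with _ | i
        · simp
        · rw [coeff_X_mul, coeff_derivative, leadingCoeff, h]; push_cast; ring
      have h4 := congrArg (fun u => coeff u (f.natDegree + g.natDegree)) h3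
      simp only [coeff_natCast_mul] at h4
      rw [hc f g, add_comm f.natDegree, hc g f] at h4
      have h5 : f.leadingCoeff * g.leadingCoeff * ((m * g.natDegree : ℕ) : K) =
          f.leadingCoeff * g.leadingCoeff * ((d * f.natDegree : ℕ) : K) := by
        push_cast; linear_combination h4
      have h6 := mul_left_cancel₀
        (mul_ne_zero (leadingCoeff_ne_zero.2 hf) (leadingCoeff_ne_zero.2 hg)) h5
      rw [qInt, if_pos rfl, Int.cast_sub, Int.cast_natCast, Int.cast_natCast, h6, sub_self]
    · apply qInt_eq_zero_of_pow_eq hq1 hq0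
      have h1 := coeff_normalForm_mul_top hm.symm.le hd.symm.le
      have h2 := coeff_normalForm_mul_top hd.symm.le hm.symm.le
      rw [hxy, add_comm, h2] at h1
      set f := (normalForm q x).coeff m
      set g := (normalForm q y).coeff d
      have hl : ∀ (k : ℕ) (u : K[X]),
          ((qShift q)^[k] u).leadingCoeff = (q ^ k) ^ u.natDegree * u.leadingCoeff := by
        intro k u
        rw [leadingCoeff, natDegree_qShift_iterate hq0, coeff_qShift_iterate, leadingCoeff]
      have h3 := congrArg leadingCoeff h1
      rw [leadingCoeff_mul, leadingCoeff_mul, hl, hl] at h3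
      rw [pow_mul, pow_mul]
      refine mul_left_cancel₀
        (mul_ne_zero (leadingCoeff_ne_zero.2 hf) (leadingCoeff_ne_zero.2 hg)) ?_
      linear_combination -h3
  have := (hq _).1 key
  omega

theorem eq_zero_of_normalForm_eq_zero {x : Heis q} (h : normalForm q x = 0) : x = 0 := by
  rw [← ofNormal_normalForm q x, h, map_zero]

/-- The powers of `B` are left linearly independent over the centralizer of an element of
positive order. -/
theorem eq_zero_of_sum_opB_pow_mul_eq_zero (hq0 : q ≠ 0) (hq : ∀ k : ℤ, qInt q k = 0 ↔ k = 0)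
    {x : Heis q} (hx : 0 < (normalForm q x).natDegree) (s : Finset ℕ) (c : ℕ → Heis q)
    (hc : ∀ i ∈ s, x * c i = c i * x) (hsum : ∑ i ∈ s, opB q ^ i * c i = 0) :
    ∀ i ∈ s, c i = 0 := by
  by_contra! hne
  have hx0 : normalForm q x ≠ 0 := fun h => by simp [h] at hx
  let d := s.sup fun i => (normalForm q (c i)).natDegree
  have hsum' : ∑ i ∈ s, C (X ^ i) * normalForm q (c i) = 0 := by
    have := congrArg (fun z => leftAction q z 1) hsum
    simp only [map_sum, LinearMap.sum_apply, map_zero, LinearMap.zero_apply] at this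
    rw [← this]
    exact Finset.sum_congr rfl fun i _ => (normalForm_opB_pow_mul i (c i)).symm
  obtain ⟨i₀, hi₀, hi₀'⟩ : ∃ i ∈ s, (normalForm q (c i)).coeff d ≠ 0 := by
    obtain ⟨j, hj, hj'⟩ := hne
    obtain ⟨i, hi, hid⟩ := Finset.exists_mem_eq_sup s ⟨j, hj⟩
      fun i => (normalForm q (c i)).natDegree
    have hid : d = (normalForm q (c i)).natDegree := hid
    by_cases h0 : normalForm q (c i) = 0
    · refine ⟨j, hj, ?_⟩
      have h1 : (normalForm q (c j)).natDegree ≤ d :=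
        Finset.le_sup (f := fun i => (normalForm q (c i)).natDegree) hj
      have h2 : d = 0 := by rw [hid, h0, natDegree_zero]
      have h3 : (normalForm q (c j)).natDegree = d := by omega
      rw [← h3]
      exact leadingCoeff_ne_zero.2 fun h => hj' (eq_zero_of_normalForm_eq_zero h)
    · exact ⟨i, hi, by rw [hid]; exact leadingCoeff_ne_zero.2 h0⟩
  have hdeg : ∀ i ∈ s, (normalForm q (c i)).coeff d ≠ 0 →
      (normalForm q x).natDegree * ((normalForm q (c i)).coeff d).natDegree =
        d * (normalForm q x).leadingCoeff.natDegree := by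
    intro i hi h
    have h1 : (normalForm q (c i)).natDegree = d :=
      le_antisymm (Finset.le_sup (f := fun i => (normalForm q (c i)).natDegree) hi)
        (le_natDegree_of_ne_zero h)
    have h2 := natDegree_leadingCoeff_of_commute hq0 hq (hc i hi) hx0
      (fun h' => h (by rw [h', coeff_zero]))
    rwa [leadingCoeff, h1] at h2
  have hcoeff : ∑ i ∈ s, X ^ i * (normalForm q (c i)).coeff d = 0 := by
    have := congrArg (fun z => coeff z d) hsum'
    simpa only [finsetSum_coeff, coeff_C_mul, coeff_zero] using this
  have hdis := degree_sum_eq_of_disjoint (fun i => X ^ i * (normalForm q (c i)).coeff d) s (by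
    rintro i ⟨hi, hi0⟩ j ⟨hj, hj0⟩ hij
    have hi1 := right_ne_zero_of_mul hi0
    have hj1 := right_ne_zero_of_mul hj0
    have h1 : ((normalForm q (c i)).coeff d).natDegree = ((normalForm q (c j)).coeff d).natDegree :=
      Nat.eq_of_mul_eq_mul_left hx ((hdeg i hi hi1).trans (hdeg j hj hj1).symm)
    intro h
    have h2 := natDegree_eq_of_degree_eq h
    rw [natDegree_X_pow_mul _ hi1, natDegree_X_pow_mul _ hj1] at h2
    omega)
  rw [hcoeff, degree_zero] at hdis
  have := Finset.le_sup (f := fun i => degree (X ^ i * (normalForm q (c i)).coeff d)) hi₀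
  rw [← hdis, le_bot_iff, degree_eq_bot] at this
  exact hi₀' ((mul_eq_zero.1 this).resolve_left (pow_ne_zero _ X_ne_zero))

end Order

section Det

variable {R : Type*} [CommRing R]

theorem coeff_prod_sum_of_natDegree_le {ι : Type*} (s : Finset ι) (f : ι → R[X]) (d : ι → ℕ)
    (h : ∀ i ∈ s, (f i).natDegree ≤ d i) :
    (∏ i ∈ s, f i).coeff (∑ i ∈ s, d i) = ∏ i ∈ s, (f i).coeff (d i) := by
  classical
  induction s using Finset.induction_on with
  | empty => simp
  | insert a s ha ih =>
    rw [Finset.prod_insert ha, Finset.sum_insert ha, Finset.prod_insert ha,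
      coeff_mul_add_eq_of_natDegree_le (h a (Finset.mem_insert_self a s)), ih]
    · exact fun i hi => h i (Finset.mem_insert_of_mem hi)
    · exact (natDegree_prod_le _ _).trans
        (Finset.sum_le_sum fun i hi => h i (Finset.mem_insert_of_mem hi))

variable {ι : Type*} [Fintype ι] [DecidableEq ι]

theorem natDegree_det_le_of_rows {M : Matrix ι ι R[X]} {d : ι → ℕ}
    (h : ∀ i j, (M i j).natDegree ≤ d i) : M.det.natDegree ≤ ∑ i, d i := by
  rw [Matrix.det_apply]
  refine natDegree_sum_le_of_forall_le _ _ fun σ _ => (natDegree_smul_le _ _).trans ?_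
  refine (natDegree_prod_le _ _).trans ?_
  rw [← Equiv.sum_comp σ d]
  exact Finset.sum_le_sum fun i _ => h _ _

theorem coeff_det_of_rows {M : Matrix ι ι R[X]} {d : ι → ℕ}
    (h : ∀ i j, (M i j).natDegree ≤ d i) :
    M.det.coeff (∑ i, d i) = (Matrix.of fun i j => (M i j).coeff (d i)).det := by
  rw [Matrix.det_apply, Matrix.det_apply, finsetSum_coeff]
  refine Finset.sum_congr rfl fun σ _ => ?_
  rw [coeff_smul, ← Equiv.sum_comp σ d, coeff_prod_sum_of_natDegree_le _ _ _ fun i _ => h _ _]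
  rfl

end Det

@[to_additive]
theorem prod_fin_ite_lt {α : Type*} [CommMonoid α] (m n : ℕ) (f g : ℕ → α) :
    ∏ i : Fin (m + n), (if (i : ℕ) < n then f i else g (i - n)) =
      (∏ k ∈ Finset.range n, f k) * ∏ l ∈ Finset.range m, g l := by
  rw [Fin.prod_univ_eq_prod_range (fun i => if i < n then f i else g (i - n)) (m + n), add_comm,
    Finset.prod_range_add]
  congr 1
  · exact Finset.prod_congr rfl fun k hk => if_pos (Finset.mem_range.1 hk)
  · exact Finset.prod_congr rfl fun k _ => by simp

theorem sign_finRotate_pow (m n : ℕ) :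
    (((finRotate (m + n)) ^ n).sign : ℤˣ) = (-1) ^ (m * n) := by
  rw [map_pow, sign_finRotate, ← pow_mul]
  rcases n with _ | n
  · simp
  · rw [Nat.add_succ_sub_one, add_mul, pow_add, (Nat.even_mul_succ_self n).neg_one_pow, mul_one]

theorem val_finRotate_pow (N k : ℕ) (i : Fin N) :
    (((finRotate N) ^ k) i : ℕ) = (i + k) % N := by
  rcases N with _ | N
  · exact i.elim0
  induction k with
  | zero => simp [Nat.mod_eq_of_lt i.2]
  | succ k ih =>
    rw [pow_succ', Equiv.Perm.mul_apply, finRotate_apply, Fin.val_add, ih, Fin.val_one',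
      ← add_assoc]
    simp [Nat.add_mod]

section LeadingCoeff

variable {K : Type*} [Field K] {q : K}

theorem inVar_X (v i : Fin 3) : inVar (K := K) v (MvPolynomial.X i) =
    (v.insertNth Polynomial.X fun j => Polynomial.C (MvPolynomial.X j) :
      Fin 3 → Polynomial (MvPolynomial (Fin 2) K)) i := by
  rw [inVar, MvPolynomial.aeval_X]

theorem inVar_aeval_X_zero {v : Fin 3}
    (hv : inVar (K := K) v (MvPolynomial.X 0) = C (MvPolynomial.X 0)) (f : K[X]) :
    inVar v (aeval (MvPolynomial.X 0) f) =
      C (aeval (MvPolynomial.X 0 : MvPolynomial (Fin 2) K) f) := by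
  rw [← aeval_algHom_apply, hv]
  exact aeval_algHom_apply
    (CAlgHom : MvPolynomial (Fin 2) K →ₐ[K] (MvPolynomial (Fin 2) K)[X]) (MvPolynomial.X 0) f

theorem inVar_one_X_zero : inVar (K := K) 1 (MvPolynomial.X 0) = C (MvPolynomial.X 0) :=
  inVar_X 1 0

theorem inVar_one_X_one : inVar (K := K) 1 (MvPolynomial.X 1) = X := inVar_X 1 1

theorem inVar_one_X_two : inVar (K := K) 1 (MvPolynomial.X 2) = C (MvPolynomial.X 1) :=
  inVar_X 1 2

theorem inVar_two_X_zero : inVar (K := K) 2 (MvPolynomial.X 0) = C (MvPolynomial.X 0) :=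
  inVar_X 2 0

theorem inVar_two_X_one : inVar (K := K) 2 (MvPolynomial.X 1) = C (MvPolynomial.X 1) :=
  inVar_X 2 1

theorem inVar_two_X_two : inVar (K := K) 2 (MvPolynomial.X 2) = X := inVar_X 2 2

theorem inVar_zero_X_zero : inVar (K := K) 0 (MvPolynomial.X 0) = X := inVar_X 0 0

theorem inVar_zero_X_one : inVar (K := K) 0 (MvPolynomial.X 1) = C (MvPolynomial.X 0) :=
  inVar_X 0 1

theorem inVar_zero_X_two : inVar (K := K) 0 (MvPolynomial.X 2) = C (MvPolynomial.X 1) :=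
  inVar_X 0 2

theorem scaled_pow_eq_aeval (k : ℕ) (f : K[X]) :
    scaled (q ^ k) f = aeval (MvPolynomial.X 0) ((qShift q)^[k] f) := by
  rw [aeval_def, eval₂_eq_sum, sum_eq_of_subset (s := f.support) _ (by simp)]
  · exact Finset.sum_congr rfl fun i _ => by rw [coeff_qShift_iterate, mul_comm (f.coeff i)]; rfl
  · intro i
    simp only [mem_support_iff, coeff_qShift_iterate]
    exact right_ne_zero_of_mul

theorem aeval_X_ne_zero {σ : Type*} (i : σ) {f : K[X]} (hf : f ≠ 0) :
    aeval (MvPolynomial.X i : MvPolynomial σ K) f ≠ 0 := by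
  intro h
  apply hf
  have h1 := congrArg (MvPolynomial.aeval fun _ : σ => (X : K[X])) h
  rwa [← aeval_algHom_apply, MvPolynomial.aeval_X, aeval_X_left_apply, map_zero] at h1

theorem scaled_pow_ne_zero (hq0 : q ≠ 0) (k : ℕ) {f : K[X]} (hf : f ≠ 0) :
    scaled (q ^ k) f ≠ 0 := by
  rw [scaled_pow_eq_aeval]
  refine aeval_X_ne_zero 0 fun h => hf ?_
  ext i
  have := congrArg (fun u => coeff u i) h
  simp only [coeff_qShift_iterate, coeff_zero] at this
  exact (mul_eq_zero.1 this).resolve_left (pow_ne_zero _ (pow_ne_zero _ hq0))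

theorem coeff_normalForm_opA_pow_mul_top {P : Heis q} {m : ℕ}
    (hP : (normalForm q P).natDegree ≤ m) (k : ℕ) :
    (normalForm q (opA q ^ k * P)).coeff (m + k) = (qShift q)^[k] ((normalForm q P).coeff m) := by
  rw [normalForm_opA_pow_mul, coeff_leftA_pow_top hP]

theorem coeff_normalForm_opA_pow_mul_eq_zero {P : Heis q} {m : ℕ}
    (hP : (normalForm q P).natDegree ≤ m) {k j : ℕ} (h : m + k < j) :
    (normalForm q (opA q ^ k * P)).coeff j = 0 := by
  rw [normalForm_opA_pow_mul]
  exact coeff_eq_zero_of_natDegree_lt ((natDegree_leftA_pow_le hP k).trans_lt h)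

theorem inVar_eliminant (v : Fin 3) (m n : ℕ) (P Q : Heis q) :
    inVar v (eliminant q m n P Q) =
      ((inVar v).mapMatrix (eliminantMatrix q m n P Q)).det := by
  rw [eliminant, AlgHom.map_det]

theorem natDegree_inVar_one_entry (m n : ℕ) (P Q : Heis q) (i j : Fin (m + n)) :
    ((inVar 1).mapMatrix (eliminantMatrix q m n P Q) i j).natDegree ≤
      if (i : ℕ) < n then 1 else 0 := by
  simp only [AlgHom.mapMatrix_apply, Matrix.map_apply, eliminantMatrix, Matrix.of_apply]
  split_ifs <;>
  simp only [map_sub, inVar_aeval_X_zero inVar_one_X_zero, inVar_one_X_one, inVar_one_X_two,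
    sub_zero] <;>
  compute_degree!

theorem natDegree_inVar_two_entry (m n : ℕ) (P Q : Heis q) (i j : Fin (m + n)) :
    ((inVar 2).mapMatrix (eliminantMatrix q m n P Q) i j).natDegree ≤
      if (i : ℕ) < n then 0 else 1 := by
  simp only [AlgHom.mapMatrix_apply, Matrix.map_apply, eliminantMatrix, Matrix.of_apply]
  split_ifs <;>
  simp only [map_sub, inVar_aeval_X_zero inVar_two_X_zero, inVar_two_X_one, inVar_two_X_two,
    sub_zero] <;>
  compute_degree!

theorem natDegree_inVar_one_eliminant_le (m n : ℕ) (P Q : Heis q) :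
    (inVar 1 (eliminant q m n P Q)).natDegree ≤ n := by
  rw [inVar_eliminant]
  refine (natDegree_det_le_of_rows (natDegree_inVar_one_entry m n P Q)).trans_eq ?_
  rw [sum_fin_ite_lt m n (fun _ => 1) fun _ => 0]
  simp

theorem natDegree_inVar_two_eliminant_le (m n : ℕ) (P Q : Heis q) :
    (inVar 2 (eliminant q m n P Q)).natDegree ≤ m := by
  rw [inVar_eliminant]
  refine (natDegree_det_le_of_rows (natDegree_inVar_two_entry m n P Q)).trans_eq ?_
  rw [sum_fin_ite_lt m n (fun _ => 0) fun _ => 1]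
  simp

theorem coeff_inVar_one_eliminant {m n : ℕ} (hn : 1 ≤ n) (P : Heis q) {Q : Heis q}
    (hQ : (normalForm q Q).natDegree ≤ n) :
    (inVar 1 (eliminant q m n P Q)).coeff n =
      (-1) ^ n * ∏ k ∈ Finset.range m, scaled (q ^ k) ((normalForm q Q).coeff n) := by
  have hsum : ∑ i : Fin (m + n), (if (i : ℕ) < n then 1 else 0) = n := by
    rw [sum_fin_ite_lt m n (fun _ => 1) fun _ => 0]
    simp
  have h := coeff_det_of_rows (natDegree_inVar_one_entry m n P Q)
  rw [hsum, ← inVar_eliminant] at h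
  have hlow : ∀ i j : Fin (m + n), i ≤ j →
      ((inVar 1).mapMatrix (eliminantMatrix q m n P Q) i j).coeff (if (i : ℕ) < n then 1 else 0) =
        if i = j then (if (i : ℕ) < n then -1 else
          scaled (q ^ ((i : ℕ) - n)) ((normalForm q Q).coeff n)) else 0 := by
    intro i j hij
    have hij' : (i : ℕ) ≤ j := hij
    simp only [AlgHom.mapMatrix_apply, Matrix.map_apply, eliminantMatrix, Matrix.of_apply]
    by_cases hi : (i : ℕ) < n
    · simp only [if_pos hi, map_sub, inVar_aeval_X_zero inVar_one_X_zero, coeff_sub]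
      by_cases h1 : i = j
      · subst h1
        simp [inVar_one_X_one]
      · have h2 : (j : ℕ) ≠ i := fun h => h1 (Fin.ext h.symm)
        simp [h1, h2]
    · have h2 : (j : ℕ) ≠ i - n := by omega
      simp only [if_neg hi, if_neg h2, sub_zero,
        inVar_aeval_X_zero inVar_one_X_zero, coeff_C_zero]
      by_cases h1 : i = j
      · subst h1
        rw [if_pos rfl, scaled_pow_eq_aeval, ← coeff_normalForm_opA_pow_mul_top hQ]
        congr 3
        omega
      · have h3 : (j : ℕ) ≠ i := fun h => h1 (Fin.ext h.symm)
        rw [if_neg h1, coeff_normalForm_opA_pow_mul_eq_zero hQ (by omega), map_zero]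
  rw [h, Matrix.det_of_isLowerTriangular]
  · simp only [Matrix.of_apply]
    rw [Finset.prod_congr rfl fun i _ => (hlow i i le_rfl).trans (if_pos rfl),
      prod_fin_ite_lt m n (fun _ => -1) fun l => scaled (q ^ l) ((normalForm q Q).coeff n)]
    simp
  · intro i j hij
    have hij : i < j := hij
    rw [Matrix.of_apply, hlow i j hij.le, if_neg hij.ne]

theorem coeff_inVar_two_eliminant {m n : ℕ} (hm : 1 ≤ m) {P : Heis q} (Q : Heis q)
    (hP : (normalForm q P).natDegree ≤ m) :
    (inVar 2 (eliminant q m n P Q)).coeff m =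
      (-1) ^ (m * (n + 1)) *
        ∏ k ∈ Finset.range n, scaled (q ^ k) ((normalForm q P).coeff m) := by
  have hsum : ∑ i : Fin (m + n), (if (i : ℕ) < n then 0 else 1) = m := by
    rw [sum_fin_ite_lt m n (fun _ => 0) fun _ => 1]
    simp
  have h := coeff_det_of_rows (natDegree_inVar_two_entry m n P Q)
  rw [hsum, ← inVar_eliminant] at h
  set N := Matrix.of fun i j : Fin (m + n) =>
    ((inVar 2).mapMatrix (eliminantMatrix q m n P Q) i j).coeff (if (i : ℕ) < n then 0 else 1)
    with hN
  set τ : Equiv.Perm (Fin (m + n)) := (finRotate (m + n)) ^ n with hτ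
  have hτ1 : ∀ i : Fin (m + n), (i : ℕ) < m → (τ i : ℕ) = i + n := fun i hi => by
    rw [hτ, val_finRotate_pow, Nat.mod_eq_of_lt (by omega)]
  have hτ2 : ∀ i : Fin (m + n), ¬ (i : ℕ) < m → (τ i : ℕ) = i - m := fun i hi => by
    have := i.2
    rw [hτ, val_finRotate_pow, show (i : ℕ) + n = (i - m) + (m + n) by omega,
      Nat.add_mod_right, Nat.mod_eq_of_lt (by omega)]
  have hlow : ∀ i j : Fin (m + n), i ≤ j → N (τ i) j =
        if i = j then (if (i : ℕ) < m then -1 else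
          scaled (q ^ ((i : ℕ) - m)) ((normalForm q P).coeff m)) else 0 := by
    intro i j hij
    have hij' : (i : ℕ) ≤ j := hij
    have := i.2
    simp only [hN, AlgHom.mapMatrix_apply, Matrix.map_apply, eliminantMatrix, Matrix.of_apply]
    by_cases hi : (i : ℕ) < m
    · have h0 : ¬ (τ i : ℕ) < n := by rw [hτ1 i hi]; omega
      simp only [if_neg h0, map_sub, inVar_aeval_X_zero inVar_two_X_zero, coeff_sub]
      rw [hτ1 i hi, Nat.add_sub_cancel, if_pos hi]
      by_cases h1 : i = j
      · subst h1
        simp [inVar_two_X_two]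
      · have h2 : (j : ℕ) ≠ i := fun h => h1 (Fin.ext h.symm)
        simp [h1, h2]
    · have h0 : (i : ℕ) - m < n := by omega
      have h2 : (j : ℕ) ≠ i - m := by omega
      simp only [hτ2 i hi, if_pos h0, if_neg h2, if_neg hi, sub_zero,
        inVar_aeval_X_zero inVar_two_X_zero, coeff_C_zero]
      by_cases h1 : i = j
      · subst h1
        rw [if_pos rfl, scaled_pow_eq_aeval, ← coeff_normalForm_opA_pow_mul_top hP]
        congr 3
        omega
      · have h3 : (j : ℕ) ≠ i := fun h => h1 (Fin.ext h.symm)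
        rw [if_neg h1, coeff_normalForm_opA_pow_mul_eq_zero hP (by omega), map_zero]
  have hdet := Matrix.det_permute τ N
  have htri : (N.submatrix τ id).det =
      (-1) ^ m * ∏ k ∈ Finset.range n, scaled (q ^ k) ((normalForm q P).coeff m) := by
    rw [Matrix.det_of_isLowerTriangular]
    · simp only [Matrix.submatrix_apply, id]
      rw [Finset.prod_congr rfl fun i _ => (hlow i i le_rfl).trans (if_pos rfl)]
      have := prod_fin_ite_lt n m (fun _ => -1)
        fun l => scaled (q ^ l) ((normalForm q P).coeff m)
      rw [Finset.prod_const, Finset.card_range] at this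
      rw [← this]
      exact Fintype.prod_equiv (finCongr (add_comm m n)) _ _ fun i => rfl
    · intro i j hij
      have hij : i < j := hij
      rw [Matrix.submatrix_apply, id, hlow i j hij.le, if_neg hij.ne]
  rw [htri, hτ, sign_finRotate_pow] at hdet
  have hs : ((((-1 : ℤˣ) ^ (m * n) : ℤˣ) : ℤ) : MvPolynomial (Fin 2) K) = (-1) ^ (m * n) := by
    push_cast; rfl
  rw [hs] at hdet
  rw [h, mul_add, mul_one, pow_add, mul_assoc, hdet, ← mul_assoc, ← pow_add,
    (Even.add_self (m * n)).neg_one_pow, one_mul]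

end LeadingCoeff

section QBounded

variable {K : Type*} [Field K] {S : Subring K} {q : K}

/-- `x` is a polynomial in `q` of degree at most `a` with coefficients in `S`. -/
def QBounded (S : Subring K) (q : K) (a : ℕ) (x : K) : Prop :=
  ∃ f : S[X], f.natDegree ≤ a ∧ aeval q f = x

namespace QBounded

variable {a b : ℕ} {x y : K}

theorem mono (h : QBounded S q a x) (hab : a ≤ b) : QBounded S q b x :=
  let ⟨f, hf, hx⟩ := h
  ⟨f, hf.trans hab, hx⟩

theorem add (hx : QBounded S q a x) (hy : QBounded S q a y) : QBounded S q a (x + y) :=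
  let ⟨f, hf, hfx⟩ := hx
  let ⟨g, hg, hgy⟩ := hy
  ⟨f + g, natDegree_add_le_of_degree_le hf hg, by rw [map_add, hfx, hgy]⟩

theorem neg (hx : QBounded S q a x) : QBounded S q a (-x) :=
  let ⟨f, hf, hfx⟩ := hx
  ⟨-f, by rwa [natDegree_neg], by rw [map_neg, hfx]⟩

theorem mul (hx : QBounded S q a x) (hy : QBounded S q b y) : QBounded S q (a + b) (x * y) :=
  let ⟨f, hf, hfx⟩ := hx
  let ⟨g, hg, hgy⟩ := hy
  ⟨f * g, natDegree_mul_le_of_le hf hg, by rw [map_mul, hfx, hgy]⟩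

theorem of_mem (hx : x ∈ S) : QBounded S q a x :=
  ⟨C ⟨x, hx⟩, by simp, by rw [aeval_C]; rfl⟩

theorem zero : QBounded S q a 0 := of_mem S.zero_mem

theorem one : QBounded S q a 1 := of_mem S.one_mem

theorem pow (i : ℕ) : QBounded S q i (q ^ i) :=
  ⟨X ^ i, natDegree_X_pow_le i, by simp⟩

theorem qInt (i : ℕ) : QBounded S q i (qInt q ((i + 1 : ℕ) : ℤ)) := by
  induction i with
  | zero =>
    rw [qInt_succ, Nat.cast_zero, qInt_zero, mul_zero, add_zero]
    exact one
  | succ i ih =>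
    rw [qInt_succ]
    refine one.add ?_
    have := (pow (S := S) (q := q) 1).mul ih
    rwa [pow_one, add_comm] at this

theorem sum {ι : Type*} (s : Finset ι) {f : ι → K} (h : ∀ i ∈ s, QBounded S q a (f i)) :
    QBounded S q a (∑ i ∈ s, f i) :=
  Finset.sum_induction _ _ (fun _ _ => add) zero h

theorem exists_sum (h : QBounded S q a x) :
    ∃ c : ℕ → K, (∀ l, c l ∈ S) ∧ x = ∑ l ∈ Finset.range (a + 1), c l * q ^ l := by
  obtain ⟨f, hf, rfl⟩ := h
  refine ⟨fun l => f.coeff l, fun l => (f.coeff l).2, ?_⟩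
  rw [aeval_eq_sum_range' (Nat.lt_succ_of_le hf)]
  rfl

end QBounded

/-- All coefficients are `QBounded`. -/
def CoeffQBounded {σ : Type*} (S : Subring K) (q : K) (a : ℕ) (F : (MvPolynomial σ K)[X]) : Prop :=
  ∀ i d, QBounded S q a ((F.coeff i).coeff d)

namespace CoeffQBounded

variable {σ : Type*} {a b : ℕ} {F G : (MvPolynomial σ K)[X]}

theorem add (hF : CoeffQBounded S q a F) (hG : CoeffQBounded S q a G) :
    CoeffQBounded S q a (F + G) := fun i d => by
  rw [coeff_add, MvPolynomial.coeff_add]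
  exact (hF i d).add (hG i d)

theorem neg (hF : CoeffQBounded S q a F) : CoeffQBounded S q a (-F) := fun i d => by
  rw [coeff_neg, MvPolynomial.coeff_neg]
  exact (hF i d).neg

theorem mul (hF : CoeffQBounded S q a F) (hG : CoeffQBounded S q b G) :
    CoeffQBounded S q (a + b) (F * G) := fun i d => by
  classical
  rw [coeff_mul, MvPolynomial.coeff_sum]
  refine QBounded.sum _ fun x _ => ?_
  rw [MvPolynomial.coeff_mul]
  exact QBounded.sum _ fun y _ => (hF _ _).mul (hG _ _)

theorem zero : CoeffQBounded S q a (0 : (MvPolynomial σ K)[X]) := fun i d => by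
  rw [coeff_zero, MvPolynomial.coeff_zero]
  exact QBounded.zero

theorem C_of_coeff {f : MvPolynomial σ K} (h : ∀ d, QBounded S q a (f.coeff d)) :
    CoeffQBounded S q a (C f) := fun i d => by
  rw [coeff_C]
  split_ifs
  · exact h d
  · exact QBounded.zero

theorem one : CoeffQBounded S q a (1 : (MvPolynomial σ K)[X]) := by
  classical
  refine C_of_coeff fun d => ?_
  rw [MvPolynomial.coeff_one]
  split_ifs
  exacts [QBounded.one, QBounded.zero]

theorem C_X (v : σ) : CoeffQBounded S q a (C (MvPolynomial.X v) : (MvPolynomial σ K)[X]) := by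
  classical
  refine C_of_coeff fun d => ?_
  rw [MvPolynomial.coeff_X]
  split_ifs
  exacts [QBounded.one, QBounded.zero]

theorem aeval_X {f : K[X]} (h : ∀ i, QBounded S q a (f.coeff i)) :
    CoeffQBounded S q a (aeval (X : (MvPolynomial σ K)[X]) f) := fun i d => by
  classical
  rw [aeval_X_left_eq_map, coeff_map, MvPolynomial.algebraMap_eq, MvPolynomial.coeff_C]
  split_ifs
  exacts [h i, QBounded.zero]

theorem prod {ι : Type*} (s : Finset ι) {f : ι → (MvPolynomial σ K)[X]} {w : ι → ℕ}
    (h : ∀ i ∈ s, CoeffQBounded S q (w i) (f i)) :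
    CoeffQBounded S q (∑ i ∈ s, w i) (∏ i ∈ s, f i) := by
  classical
  induction s using Finset.induction_on with
  | empty => exact one
  | insert i s hi ih =>
    rw [Finset.prod_insert hi, Finset.sum_insert hi]
    exact (h i (Finset.mem_insert_self i s)).mul
      (ih fun j hj => h j (Finset.mem_insert_of_mem hj))

theorem det {ι : Type*} [Fintype ι] [DecidableEq ι] {M : Matrix ι ι (MvPolynomial σ K)[X]}
    {w : ι → ℕ} (h : ∀ i j, CoeffQBounded S q (w i) (M i j)) :
    CoeffQBounded S q (∑ i, w i) M.det := by
  rw [Matrix.det_apply]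
  refine Finset.sum_induction _ _ (fun _ _ => add) zero fun τ _ => ?_
  have h1 : CoeffQBounded S q (∑ i, w i) (∏ i, M (τ i) i) := by
    rw [← Equiv.sum_comp τ w]
    exact prod _ fun i _ => h _ _
  rcases Int.units_eq_one_or (Equiv.Perm.sign τ) with h2 | h2 <;> rw [h2]
  · rwa [one_smul]
  · rw [Units.neg_smul, one_smul]
    exact h1.neg

end CoeffQBounded

end QBounded

section Expansion

variable {K : Type*} [Field K] {S : Subring K} {q : K}

theorem natDegree_coeff_leftA_pow_le {g : K[X][X]} {D : ℕ} (hg : ∀ j, (g.coeff j).natDegree ≤ D)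
    (k j : ℕ) : (((leftA q ^ k) g).coeff j).natDegree ≤ D := by
  induction k generalizing j with
  | zero => exact hg j
  | succ k ih =>
    rw [pow_succ', Module.End.mul_apply]
    rcases j with _ | j
    · rw [coeff_leftA_zero]
      exact (natDegree_qDeriv_le _).trans (ih 0)
    · rw [coeff_leftA_succ]
      exact natDegree_add_le_of_degree_le ((natDegree_qShift_le _).trans (ih j))
        ((natDegree_qDeriv_le _).trans (ih (j + 1)))

theorem QBounded.coeff_qShift {f : K[X]} {D a : ℕ} (hf : f.natDegree ≤ D)
    (h : ∀ i, QBounded S q a (f.coeff i)) (i : ℕ) : QBounded S q (D + a) ((qShift q f).coeff i) := by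
  rw [QHeisenberg.coeff_qShift]
  by_cases hi : i ≤ D
  · exact ((QBounded.pow i).mono hi).mul (h i)
  · rw [coeff_eq_zero_of_natDegree_lt (by omega), mul_zero]
    exact QBounded.zero

theorem QBounded.coeff_qDeriv {f : K[X]} {D a : ℕ} (hf : f.natDegree ≤ D)
    (h : ∀ i, QBounded S q a (f.coeff i)) (i : ℕ) : QBounded S q (D + a) ((qDeriv q f).coeff i) := by
  rw [QHeisenberg.coeff_qDeriv]
  by_cases hi : i ≤ D
  · exact ((QBounded.qInt i).mono hi).mul (h (i + 1))
  · rw [coeff_eq_zero_of_natDegree_lt (by omega), mul_zero]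
    exact QBounded.zero

theorem QBounded.coeff_leftA_pow {g : K[X][X]} {D : ℕ} (hg : ∀ j, (g.coeff j).natDegree ≤ D)
    (h : ∀ j i, (g.coeff j).coeff i ∈ S) (k j i : ℕ) :
    QBounded S q (k * D) ((((leftA q ^ k) g).coeff j).coeff i) := by
  induction k generalizing j i with
  | zero => exact QBounded.of_mem (h j i)
  | succ k ih =>
    have hd := natDegree_coeff_leftA_pow_le (q := q) hg k
    rw [pow_succ', Module.End.mul_apply, Nat.succ_mul, add_comm]
    rcases j with _ | j
    · rw [coeff_leftA_zero]
      exact coeff_qDeriv (hd 0) (ih 0) i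
    · rw [coeff_leftA_succ, coeff_add]
      exact (coeff_qShift (hd j) (ih j) i).add (coeff_qDeriv (hd (j + 1)) (ih (j + 1)) i)

theorem natDegree_aeval_X_le {σ : Type*} (f : K[X]) :
    (aeval (X : (MvPolynomial σ K)[X]) f).natDegree ≤ f.natDegree := by
  rw [aeval_X_left_eq_map]
  exact natDegree_map_le

theorem inVar_zero_entry (m n : ℕ) (P Q : Heis q) (i j : Fin (m + n)) :
    (inVar 0).mapMatrix (eliminantMatrix q m n P Q) i j =
      if (i : ℕ) < n then aeval X ((normalForm q (opA q ^ (i : ℕ) * P)).coeff j)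
        - (if (j : ℕ) = i then C (MvPolynomial.X 0) else 0)
      else aeval X ((normalForm q (opA q ^ ((i : ℕ) - n) * Q)).coeff j)
        - (if (j : ℕ) = i - n then C (MvPolynomial.X 1) else 0) := by
  simp only [AlgHom.mapMatrix_apply, Matrix.map_apply, eliminantMatrix, Matrix.of_apply]
  rw [apply_ite (inVar 0)]
  simp only [map_sub, ← aeval_algHom_apply, apply_ite (inVar (K := K) 0), inVar_zero_X_zero,
    inVar_zero_X_one, inVar_zero_X_two, map_zero]

theorem eq_zero_of_inVar_zero_eq_zero {f : MvPolynomial (Fin 3) K} (h : inVar 0 f = 0) : f = 0 := by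
  let ψ : (MvPolynomial (Fin 2) K)[X] →ₐ[K] MvPolynomial (Fin 3) K :=
    { eval₂RingHom (MvPolynomial.rename Fin.succ : MvPolynomial (Fin 2) K →ₐ[K] _).toRingHom
        (MvPolynomial.X 0) with
      commutes' := fun a => by
        simp [Polynomial.algebraMap_apply] }
  have hψ : ψ.comp (inVar 0) = AlgHom.id K _ := by
    refine MvPolynomial.algHom_ext fun i => ?_
    fin_cases i
    · simp [ψ, inVar_zero_X_zero]
    · simp [ψ, inVar_zero_X_one]
    · simp [ψ, inVar_zero_X_two]
  have := congrArg ψ h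
  rwa [map_zero, ← AlgHom.comp_apply, hψ, AlgHom.id_apply] at this

theorem natDegree_inVar_zero_eliminant_le (m n : ℕ) {P Q : Heis q} {D E : ℕ}
    (hP : ∀ j, ((normalForm q P).coeff j).natDegree ≤ D)
    (hQ : ∀ j, ((normalForm q Q).coeff j).natDegree ≤ E) :
    (inVar 0 (eliminant q m n P Q)).natDegree ≤ n * D + m * E := by
  have h : ∀ i j : Fin (m + n), ((inVar 0).mapMatrix (eliminantMatrix q m n P Q) i j).natDegree ≤
      if (i : ℕ) < n then D else E := by
    intro i j
    rw [inVar_zero_entry]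
    split_ifs
    all_goals
      rw [normalForm_opA_pow_mul]
      refine (natDegree_sub_le _ _).trans (max_le ((natDegree_aeval_X_le _).trans
        (natDegree_coeff_leftA_pow_le ‹_› _ _)) (by simp))
  rw [inVar_eliminant]
  refine (natDegree_det_le_of_rows h).trans_eq ?_
  rw [sum_fin_ite_lt m n (fun _ => D) fun _ => E]
  simp

theorem sum_range_id_mul (n D : ℕ) : ∑ k ∈ Finset.range n, k * D = n * (n - 1) / 2 * D := by
  rw [← Finset.sum_mul, Finset.sum_range_id]

theorem coeffQBounded_inVar_zero_eliminant (m n : ℕ) {P Q : Heis q} {D E : ℕ}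
    (hP : ∀ j, ((normalForm q P).coeff j).natDegree ≤ D)
    (hQ : ∀ j, ((normalForm q Q).coeff j).natDegree ≤ E)
    (hPS : ∀ j i, ((normalForm q P).coeff j).coeff i ∈ S)
    (hQS : ∀ j i, ((normalForm q Q).coeff j).coeff i ∈ S) :
    CoeffQBounded S q (n * (n - 1) / 2 * D + m * (m - 1) / 2 * E)
      (inVar 0 (eliminant q m n P Q)) := by
  have h : ∀ i j : Fin (m + n), CoeffQBounded S q (if (i : ℕ) < n then i * D else (i - n) * E)
      ((inVar 0).mapMatrix (eliminantMatrix q m n P Q) i j) := by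
    intro i j
    rw [inVar_zero_entry]
    split_ifs
    all_goals
      rw [normalForm_opA_pow_mul, sub_eq_add_neg]
      refine (CoeffQBounded.aeval_X (QBounded.coeff_leftA_pow ‹_› ‹_› _ _)).add
        (CoeffQBounded.neg ?_)
      first | exact CoeffQBounded.C_X _ | exact CoeffQBounded.zero
  rw [inVar_eliminant]
  convert CoeffQBounded.det h using 1
  rw [sum_fin_ite_lt m n (fun k => k * D) fun k => k * E, sum_range_id_mul, sum_range_id_mul]

end Expansion

section Annihilation

variable {K : Type*} [Field K] {q : K}

open scoped IsMulCommutative in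
/-- The variables `M`, `lam`, `mu` act by left multiplication by `B` and right multiplication by
`P` and `Q`. -/
theorem exists_action (P Q : Heis q) (hPQ : P * Q = Q * P) :
    ∃ φ : (MvPolynomial (Fin 2) K)[X] →+* Module.End K (Heis q),
      (∀ x, φ X x = opB q * x) ∧ (∀ a x, φ (C (MvPolynomial.C a)) x = a • x) ∧
      (∀ x, φ (C (MvPolynomial.X 0)) x = x * P) ∧ ∀ x, φ (C (MvPolynomial.X 1)) x = x * Q := by
  let s : Set (Module.End K (Heis q)) :=
    {LinearMap.mulLeft K (opB q), LinearMap.mulRight K P, LinearMap.mulRight K Q}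
  have hs : ∀ x ∈ s, ∀ y ∈ s, x * y = y * x := by
    rintro x (rfl | rfl | rfl) y (rfl | rfl | rfl) <;> ext z <;>
      simp [mul_assoc, hPQ]
  have hc := Algebra.isMulCommutative_adjoin K hs
  let u : Fin 2 → Algebra.adjoin K s :=
    ![⟨LinearMap.mulRight K P, Algebra.subset_adjoin (by simp [s])⟩,
      ⟨LinearMap.mulRight K Q, Algebra.subset_adjoin (by simp [s])⟩]
  let b : Algebra.adjoin K s := ⟨LinearMap.mulLeft K (opB q), Algebra.subset_adjoin (by simp [s])⟩
  refine ⟨(Algebra.adjoin K s).val.toRingHom.comp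
    (eval₂RingHom (MvPolynomial.eval₂Hom (algebraMap K (Algebra.adjoin K s)) u) b), ?_, ?_, ?_, ?_⟩
  · intro x; simp [b]
  · intro a x; simp
  · intro x; simp [u]
  · intro x; simp [u]

theorem apply_C_eq_mul_evalPair {P Q : Heis q}
    {φ : (MvPolynomial (Fin 2) K)[X] →+* Module.End K (Heis q)}
    (hC : ∀ a x, φ (C (MvPolynomial.C a)) x = a • x)
    (hP : ∀ x, φ (C (MvPolynomial.X 0)) x = x * P)
    (hQ : ∀ x, φ (C (MvPolynomial.X 1)) x = x * Q) (f : MvPolynomial (Fin 2) K) (x : Heis q) :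
    φ (C f) x = x * evalPair f P Q := by
  have hP' : ∀ k x, (φ (C (MvPolynomial.X 0)) ^ k) x = x * P ^ k := by
    intro k
    induction k with
    | zero => simp
    | succ k ih => intro x; rw [pow_succ', Module.End.mul_apply, hP, ih, mul_assoc, pow_succ]
  have hQ' : ∀ k x, (φ (C (MvPolynomial.X 1)) ^ k) x = x * Q ^ k := by
    intro k
    induction k with
    | zero => simp
    | succ k ih => intro x; rw [pow_succ', Module.End.mul_apply, hQ, ih, mul_assoc, pow_succ]
  conv_lhs => rw [f.as_sum]
  rw [map_sum, map_sum, LinearMap.sum_apply, evalPair, Finset.mul_sum]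
  refine Finset.sum_congr rfl fun d _ => ?_
  rw [MvPolynomial.monomial_eq, Finsupp.prod_fintype _ _ (by simp), Fin.prod_univ_two,
    mul_comm (MvPolynomial.X 0 ^ _), map_mul, map_mul, map_mul, map_mul, map_pow, map_pow, map_pow,
    map_pow, Module.End.mul_apply, hC, Module.End.mul_apply, hP', hQ', mul_assoc, mul_smul_comm]

theorem det_apply_eq_zero {R V : Type*} [CommRing R] [AddCommGroup V] [Module K V]
    (φ : R →+* Module.End K V) {ι : Type*} [Fintype ι] [DecidableEq ι] (M : Matrix ι ι R)
    (v : ι → V) (h : ∀ i, ∑ j, φ (M i j) (v j) = 0) (k : ι) : φ M.det (v k) = 0 := by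
  have h1 : ∑ i, φ (M.adjugate k i) (∑ j, φ (M i j) (v j)) = 0 := by simp [h]
  simp only [map_sum, ← Module.End.mul_apply, ← map_mul] at h1
  rw [Finset.sum_comm] at h1
  simp only [← LinearMap.sum_apply, ← map_sum] at h1
  have h2 : ∀ j, ∑ i, M.adjugate k i * M i j = if k = j then M.det else 0 := by
    intro j
    rw [← Matrix.mul_apply, Matrix.adjugate_mul, Matrix.smul_apply, Matrix.one_apply]
    simp
  simp only [h2] at h1
  rw [← h1, Finset.sum_eq_single k]
  · simp
  · intro j _ hj
    simp [hj.symm]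
  · simp

theorem eq_sum_of_natDegree_normalForm_lt {x : Heis q} {N : ℕ}
    (hx : (normalForm q x).natDegree < N) :
    x = ∑ j : Fin N, aeval (opB q) ((normalForm q x).coeff j) * opA q ^ (j : ℕ) := by
  conv_lhs => rw [← ofNormal_normalForm q x, ofNormal, lsum_apply,
    sum_over_range' _ (by simp) N hx]
  rw [Fin.sum_univ_eq_sum_range
    (fun j => aeval (opB q) ((normalForm q x).coeff j) * opA q ^ j) N]
  rfl

theorem sum_opB_pow_mul_evalPair_eq_zero {m n : ℕ} (hmn : 0 < m + n) {P Q : Heis q}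
    (hPQ : P * Q = Q * P)
    (hP : (normalForm q P).natDegree ≤ m) (hQ : (normalForm q Q).natDegree ≤ n)
    {s : ℕ} (hs : (inVar 0 (eliminant q m n P Q)).natDegree ≤ s) :
    ∑ i ∈ Finset.range (s + 1), opB q ^ i * evalPair (eliminantCoeff q m n P Q i) P Q = 0 := by
  obtain ⟨φ, hX, hC, hφP, hφQ⟩ := exists_action P Q hPQ
  have hXp : ∀ k x, (φ X ^ k) x = opB q ^ k * x := by
    intro k
    induction k with
    | zero => simp
    | succ k ih => intro x; rw [pow_succ', Module.End.mul_apply, hX, ih, pow_succ', mul_assoc]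
  have haeval : ∀ (f : K[X]) (x : Heis q), φ (aeval X f) x = aeval (opB q) f * x := by
    intro f x
    induction f using Polynomial.induction_on' with
    | add f g hf hg => rw [map_add, map_add, LinearMap.add_apply, hf, hg, map_add, add_mul]
    | monomial i a =>
      rw [aeval_monomial, aeval_monomial, map_mul, map_pow, Module.End.mul_apply, hXp]
      change φ (C (MvPolynomial.C a)) _ = _
      rw [hC, Algebra.algebraMap_eq_smul_one, smul_mul_assoc, one_mul, smul_mul_assoc]
  have hrow : ∀ i : Fin (m + n),
      ∑ j, φ ((inVar 0).mapMatrix (eliminantMatrix q m n P Q) i j) (opA q ^ (j : ℕ)) = 0 := by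
    intro i
    have hi := i.2
    have hlt : ∀ {x : Heis q} {a k : ℕ}, (normalForm q x).natDegree ≤ a → a + k < m + n →
        (normalForm q (opA q ^ k * x)).natDegree < m + n := by
      intro x a k hx hk
      rw [normalForm_opA_pow_mul]
      exact (natDegree_leftA_pow_le hx k).trans_lt hk
    simp only [inVar_zero_entry]
    by_cases h : (i : ℕ) < n
    · simp only [if_pos h, map_sub, LinearMap.sub_apply, Finset.sum_sub_distrib, haeval]
      rw [← eq_sum_of_natDegree_normalForm_lt (hlt hP (by omega)), Finset.sum_eq_single i]
      · rw [if_pos rfl, hφP, sub_self]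
      · intro j _ hj
        rw [if_neg fun h => hj (Fin.ext h), map_zero, LinearMap.zero_apply]
      · simp
    · simp only [if_neg h, map_sub, LinearMap.sub_apply, Finset.sum_sub_distrib, haeval]
      rw [← eq_sum_of_natDegree_normalForm_lt (hlt hQ (by omega)),
        Finset.sum_eq_single ⟨(i : ℕ) - n, by omega⟩]
      · rw [if_pos rfl, hφQ, sub_self]
      · intro j _ hj
        rw [if_neg fun h => hj (Fin.ext h), map_zero, LinearMap.zero_apply]
      · simp
  have hdet := det_apply_eq_zero φ _ _ hrow ⟨0, hmn⟩
  rw [← inVar_eliminant, (inVar 0 (eliminant q m n P Q)).as_sum_range_C_mul_X_pow'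
    (Nat.lt_succ_of_le hs), map_sum, LinearMap.sum_apply] at hdet
  rw [← hdet]
  refine Finset.sum_congr rfl fun i _ => ?_
  rw [mul_comm, φ.map_mul, φ.map_pow, Module.End.mul_apply, hXp,
    apply_C_eq_mul_evalPair hC hφP hφQ, pow_zero, one_mul, eliminantCoeff]

theorem commute_evalPair {P Q : Heis q} (hPQ : P * Q = Q * P) (f : MvPolynomial (Fin 2) K) :
    P * evalPair f P Q = evalPair f P Q * P := by
  have h : Commute P Q := hPQ
  exact Commute.sum_right _ _ _ fun d _ =>
    (((Commute.refl P).pow_right _).mul_right (h.pow_right _)).smul_right _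

end Annihilation

section OfCoeffs

variable {K : Type*} [Field K] {q : K} {m : ℕ}

theorem coeff_normalForm_ofCoeffs (p : Fin (m + 1) → K[X]) (j : ℕ) :
    (normalForm q (ofCoeffs q p)).coeff j = if h : j < m + 1 then p ⟨j, h⟩ else 0 := by
  have h : ofCoeffs q p = ∑ j ∈ Finset.range (m + 1),
      aeval (opB q) (if h : j < m + 1 then p ⟨j, h⟩ else 0) * opA q ^ j := by
    rw [← Fin.sum_univ_eq_sum_range
      (fun j => aeval (opB q) (if h : j < m + 1 then p ⟨j, h⟩ else 0) * opA q ^ j)]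
    exact Finset.sum_congr rfl fun i _ => by rw [dif_pos i.2]
  rw [h, normalForm_sum, finsetSum_coeff]
  simp only [coeff_monomial, Finset.sum_ite_eq', Finset.mem_range]
  split_ifs <;> rfl

theorem natDegree_normalForm_ofCoeffs_le (p : Fin (m + 1) → K[X]) :
    (normalForm q (ofCoeffs q p)).natDegree ≤ m :=
  natDegree_le_iff_coeff_eq_zero.2 fun j hj => by
    rw [coeff_normalForm_ofCoeffs, dif_neg (by omega)]

theorem coeff_normalForm_ofCoeffs_last (p : Fin (m + 1) → K[X]) :
    (normalForm q (ofCoeffs q p)).coeff m = p (Fin.last m) := by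
  rw [coeff_normalForm_ofCoeffs, dif_pos m.lt_succ_self]
  rfl

theorem natDegree_coeff_normalForm_ofCoeffs_le (p : Fin (m + 1) → K[X]) (j : ℕ) :
    ((normalForm q (ofCoeffs q p)).coeff j).natDegree ≤ maxDeg p := by
  rw [coeff_normalForm_ofCoeffs]
  split_ifs with h
  · exact Finset.le_sup (f := fun j => (p j).natDegree) (Finset.mem_univ _)
  · simp

theorem coeff_coeff_normalForm_ofCoeffs_mem {S : Subring K} {p : Fin (m + 1) → K[X]}
    (h : ∀ j i, (p j).coeff i ∈ S) (j i : ℕ) :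
    ((normalForm q (ofCoeffs q p)).coeff j).coeff i ∈ S := by
  rw [coeff_normalForm_ofCoeffs]
  split_ifs
  · exact h _ _
  · rw [coeff_zero]
    exact S.zero_mem

end OfCoeffs

end QHeisenberg

theorem mainTheorem1 {K : Type*} [Field K] (q : K) (hq0 : q ≠ 0)
    (hq : ∀ k : ℤ, QHeisenberg.qInt q k = 0 ↔ k = 0)
    (m n : ℕ) (hm : 1 ≤ m) (hn : 1 ≤ n)
    (p : Fin (m + 1) → Polynomial K) (r : Fin (n + 1) → Polynomial K)
    (hp : p (Fin.last m) ≠ 0) (hr : r (Fin.last n) ≠ 0)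
    (P Q : QHeisenberg.Heis q)
    (hP : P = QHeisenberg.ofCoeffs q p) (hQ : Q = QHeisenberg.ofCoeffs q r)
    (hPQ : P * Q = Q * P)
    (s t : ℕ)
    (hs : s = n * QHeisenberg.maxDeg p + m * QHeisenberg.maxDeg r)
    (ht : t = n * (n - 1) / 2 * QHeisenberg.maxDeg p + m * (m - 1) / 2 * QHeisenberg.maxDeg r) :
    QHeisenberg.eliminant q m n P Q ≠ 0 ∧
    -- degree and leading coefficient in lam
    ((QHeisenberg.inVar 1 (QHeisenberg.eliminant q m n P Q)).natDegree = n ∧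
      (QHeisenberg.inVar 1 (QHeisenberg.eliminant q m n P Q)).coeff n =
        (-1) ^ n * ∏ k ∈ Finset.range m, QHeisenberg.scaled (q ^ k) (r (Fin.last n)) ∧
      (QHeisenberg.inVar 1 (QHeisenberg.eliminant q m n P Q)).coeff n ≠ 0) ∧
    -- degree and leading coefficient in mu
    ((QHeisenberg.inVar 2 (QHeisenberg.eliminant q m n P Q)).natDegree = m ∧
      (QHeisenberg.inVar 2 (QHeisenberg.eliminant q m n P Q)).coeff m =
        (-1) ^ (m * (n + 1)) *
          ∏ k ∈ Finset.range n, QHeisenberg.scaled (q ^ k) (p (Fin.last m)) ∧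
      (QHeisenberg.inVar 2 (QHeisenberg.eliminant q m n P Q)).coeff m ≠ 0) ∧
    -- expansion in powers of M
    QHeisenberg.inVar 0 (QHeisenberg.eliminant q m n P Q) =
      ∑ i ∈ Finset.range (s + 1),
        Polynomial.C (QHeisenberg.eliminantCoeff q m n P Q i) * Polynomial.X ^ i ∧
    (∀ i ≤ s, ∀ d : Fin 2 →₀ ℕ, ∃ c : ℕ → K,
      (∀ l, c l ∈ QHeisenberg.coeffRing p r) ∧
      (QHeisenberg.eliminantCoeff q m n P Q i).coeff d =
        ∑ l ∈ Finset.range (t + 1), c l * q ^ l) ∧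
    (∃ i ≤ s, QHeisenberg.eliminantCoeff q m n P Q i ≠ 0) ∧
    (∀ i ≤ s, QHeisenberg.evalPair (QHeisenberg.eliminantCoeff q m n P Q i) P Q = 0) := by
  open QHeisenberg in
  have hPd : (normalForm q P).natDegree ≤ m := hP ▸ natDegree_normalForm_ofCoeffs_le p
  have hQd : (normalForm q Q).natDegree ≤ n := hQ ▸ natDegree_normalForm_ofCoeffs_le r
  have hPm : (normalForm q P).coeff m = p (Fin.last m) := hP ▸ coeff_normalForm_ofCoeffs_last p
  have hQn : (normalForm q Q).coeff n = r (Fin.last n) := hQ ▸ coeff_normalForm_ofCoeffs_last r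
  have hPD : ∀ j, ((normalForm q P).coeff j).natDegree ≤ maxDeg p :=
    hP ▸ natDegree_coeff_normalForm_ofCoeffs_le p
  have hQD : ∀ j, ((normalForm q Q).coeff j).natDegree ≤ maxDeg r :=
    hQ ▸ natDegree_coeff_normalForm_ofCoeffs_le r
  have hPS : ∀ j i, ((normalForm q P).coeff j).coeff i ∈ coeffRing p r :=
    hP ▸ coeff_coeff_normalForm_ofCoeffs_mem
      fun j i => Subring.subset_closure (Or.inl ⟨j, i, rfl⟩)
  have hQS : ∀ j i, ((normalForm q Q).coeff j).coeff i ∈ coeffRing p r :=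
    hQ ▸ coeff_coeff_normalForm_ofCoeffs_mem
      fun j i => Subring.subset_closure (Or.inr ⟨j, i, rfl⟩)
  have hlam : (inVar 1 (eliminant q m n P Q)).coeff n =
      (-1) ^ n * ∏ k ∈ Finset.range m, scaled (q ^ k) (r (Fin.last n)) :=
    hQn ▸ coeff_inVar_one_eliminant hn P hQd
  have hmu : (inVar 2 (eliminant q m n P Q)).coeff m =
      (-1) ^ (m * (n + 1)) * ∏ k ∈ Finset.range n, scaled (q ^ k) (p (Fin.last m)) :=
    hPm ▸ coeff_inVar_two_eliminant hm Q hPd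
  have hlam0 : (inVar 1 (eliminant q m n P Q)).coeff n ≠ 0 := by
    rw [hlam]
    exact mul_ne_zero (pow_ne_zero _ (neg_ne_zero.2 one_ne_zero))
      (Finset.prod_ne_zero_iff.2 fun k _ => scaled_pow_ne_zero hq0 k hr)
  have hmu0 : (inVar 2 (eliminant q m n P Q)).coeff m ≠ 0 := by
    rw [hmu]
    exact mul_ne_zero (pow_ne_zero _ (neg_ne_zero.2 one_ne_zero))
      (Finset.prod_ne_zero_iff.2 fun k _ => scaled_pow_ne_zero hq0 k hp)
  have hsd : (inVar 0 (eliminant q m n P Q)).natDegree ≤ s :=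
    hs ▸ natDegree_inVar_zero_eliminant_le m n hPD hQD
  have hord : 0 < (normalForm q P).natDegree :=
    hm.trans (Polynomial.le_natDegree_of_ne_zero (hPm ▸ hp))
  have hann : ∀ i ≤ s, evalPair (eliminantCoeff q m n P Q i) P Q = 0 := fun i hi =>
    eq_zero_of_sum_opB_pow_mul_eq_zero hq0 hq hord (Finset.range (s + 1))
      (fun i => evalPair (eliminantCoeff q m n P Q i) P Q)
      (fun i _ => commute_evalPair hPQ _)
      (sum_opB_pow_mul_evalPair_eq_zero (by omega) hPQ hPd hQd hsd) i
      (Finset.mem_range.2 (Nat.lt_succ_of_le hi))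
  refine ⟨fun h => hlam0 (by rw [h, map_zero, Polynomial.coeff_zero]),
    ⟨le_antisymm (natDegree_inVar_one_eliminant_le m n P Q)
      (Polynomial.le_natDegree_of_ne_zero hlam0), hlam, hlam0⟩,
    ⟨le_antisymm (natDegree_inVar_two_eliminant_le m n P Q)
      (Polynomial.le_natDegree_of_ne_zero hmu0), hmu, hmu0⟩,
    Polynomial.as_sum_range_C_mul_X_pow' _ (Nat.lt_succ_of_le hsd), fun i _ d => ?_, ?_, hann⟩
  · exact (ht ▸ coeffQBounded_inVar_zero_eliminant m n hPD hQD hPS hQS i d :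
      QBounded (coeffRing p r) q t _).exists_sum
  · by_contra! h
    have h0 : inVar 0 (eliminant q m n P Q) = 0 := by
      rw [Polynomial.as_sum_range_C_mul_X_pow' _ (Nat.lt_succ_of_le hsd)]
      refine Finset.sum_eq_zero fun i hi => ?_
      have := h i (Nat.le_of_lt_succ (Finset.mem_range.1 hi))
      rw [eliminantCoeff] at this
      rw [this, Polynomial.C_0, zero_mul]
    exact hlam0 (by rw [eq_zero_of_inVar_zero_eq_zero h0, map_zero, Polynomial.coeff_zero])
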